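/- **Theorem.** Let $(\rho_n)_{n\ge 1}$ be the zeros of the Riemann zeta function with $\Im\rho>0$, each repeated according to its multiplicity, and write $\rho_n=\frac12+i\alpha_n$ (the Riemann Hypothesis is not assumed, so $\alpha_n\in\mathbb{C}$). Fix a real number $a>0$. For $x>0$ put $$f(x)=\sum_{n} e^{-\alpha_n^2x},$$ a series that converges absolutely, and for $s\in\mathbb{C}$ put $$A(s)=\frac{1}{\Gamma(s/2)}\int_a^{\infty} f(x)\,x^{\frac s2-1}\,dx,$$ where $1/\Gamma$ is understood as an entire function (equal to $0$ at the poles of $\Gamma$). The integral converges absolutely for every $s\in\mathbb{C}$, $A$ is an entire function, and $$A(s)=\sum_{n}\frac{\Gamma\left(\frac s2,\,a\alpha_n^2\right)}{\Gamma\left(\frac s2\right)}\,\frac{1}{\alpha_n^{s}}\qquad(s\in\mathbb{C}),$$ where the series converges unconditionally and locally uniformly on $\mathbb{C}$; in particular, its partial sums converge to $A$ locally uniformly on $\mathbb{C}$ for every arrangement of the zeros in a sequence. Here $\alpha_n^s$ is the principal power, and $\Gamma(w,z)=\int_z^{\infty}t^{w-1}e^{-t}\,dt$ is the upper incomplete gamma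 function for $z\in\mathbb{C}\setminus(-\infty,0]$, with the principal branch of $t^{w-1}$ and the integral taken along the horizontal ray $t=z+u$, $0<u<\infty$. These integrals converge absolutely for $w=\frac s2$, $z=a\alpha_n^2$, and all the points $a\alpha_n^2$ lie in $\mathbb{C}\setminus(-\infty,0]$. -/

import Mathlib

namespace SecondaryZeta

/-- The zeros of the Riemann zeta function in the open upper half-plane. -/
def UpperZero : Type := {ρ : ℂ // riemannZeta ρ = 0 ∧ 0 < ρ.im}

/-- The zeros of the Riemann zeta function in the open upper half-plane, each one repeated
according to its order of multiplicity: a zero `ρ` of order `m` occurs as the `m` indices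
`⟨ρ, 0⟩, …, ⟨ρ, m - 1⟩`. -/
def ZeroIndex : Type := Σ ρ : UpperZero, Fin (analyticOrderNatAt riemannZeta ρ.1)

/-- The zero `ρ` itself. -/
def ZeroIndex.zero (i : ZeroIndex) : ℂ := i.1.1

/-- The complex number `α` with `ρ = 1/2 + i α`. -/
noncomputable def ZeroIndex.alpha (i : ZeroIndex) : ℂ := (i.zero - 1 / 2) / Complex.I

theorem ZeroIndex.zero_eq (i : ZeroIndex) : i.zero = 1 / 2 + Complex.I * i.alpha := by
  rw [ZeroIndex.alpha, mul_div_cancel₀ _ Complex.I_ne_zero]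
  ring

/-- `f(z) = ∑ exp (-α ^ 2 * z)`, the sum over all zeros in the open upper half-plane, with
multiplicity. -/
noncomputable def f (z : ℂ) : ℂ := ∑' i : ZeroIndex, Complex.exp (-i.alpha ^ 2 * z)

/-- The upper incomplete gamma function `Γ(s, z) = ∫_z^∞ t ^ (s - 1) * exp (-t) dt` for `z` off
the cut `(-∞, 0]`: principal branch of the power, integral along the ray `t = z + u`, `u > 0`,
which stays off the cut. -/
noncomputable def incompleteGamma (s z : ℂ) : ℂ :=
  ∫ u : ℝ in Set.Ioi 0, (z + u) ^ (s - 1) * Complex.exp (-(z + u))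

/-- The zero-side term `A(s) = Γ(s/2)⁻¹ ∫_a^∞ f(x) x ^ (s/2 - 1) dx`. At the poles of `Γ(s/2)` the
library's `Complex.Gamma` is zero, so `(Complex.Gamma (s / 2))⁻¹` is the entire function `1/Γ(s/2)`
for every `s`. -/
noncomputable def A (a : ℝ) (s : ℂ) : ℂ :=
  (Complex.Gamma (s / 2))⁻¹ * ∫ x : ℝ in Set.Ioi a, f x * (x : ℂ) ^ (s / 2 - 1)

/-- One term `Γ(s/2, a α ^ 2) / Γ(s/2) * 1 / α ^ s` of the series for `A(s)`. -/
noncomputable def seriesTerm (a : ℝ) (i : ZeroIndex) (s : ℂ) : ℂ :=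
  incompleteGamma (s / 2) (a * i.alpha ^ 2) / Complex.Gamma (s / 2) * (1 / i.alpha ^ s)

end SecondaryZeta

/-! Everything rests on a lower bound for Re α² and on the zeros not being too dense. With ρ = σ +
it, Re α² = t² - (1/2 - σ)², which a low zero off the critical line could make negative. Such zeros
are excluded directly: comparing the Dirichlet series of ζ with an integral gives |s - (s-1)ζ(s)| ≤
|s||s-1|/(2 Re s) for Re s > 0 (`norm_sub_riemannZeta₁_le`). At a nonreal zero this and the
functional equation force t² ≥ 3/4, hence Re α² ≥ 1/2.

The entire function s(1-s)Λ(s) grows at most like exp(O(|s|²)), so Jensen's inequality leaves only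
O(r²) zeros in |s| ≤ r for r ≥ 1 (`exists_finset_zeroIndex`). Therefore ∑ exp(-x Re α²) converges
for every x > 0.

One term of f integrates to α^(-s) Γ(s/2, aα²). This is ∫_a^∞ e^(-zx) x^(w-1) dx = z^(-w) Γ(w, az)
at z = α², w = s/2: a substitution for z > 0, and the identity theorem for Re z > 0
(`integral_exp_mul_cpow`), so no contour has to be moved. The integrals of the norms are at most C
exp(-(a/2) Re α²), with C uniform for s in a compact set. This justifies integrating term by term
and gives locally uniform convergence by the Weierstrass M-test. That A is entire follows by reading
its integral as the Mellin transform of f cut off below a. -/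

namespace SecondaryZeta
open Complex MeasureTheory Set Filter Topology

/-! ### An explicit bound for (s-1)ζ(s) in Re s > 0 -/

/-- The difference between `∫_a^{a+1} (s - 1) x ^ (-s) dx` and `(s - 1) (a + 1) ^ (-s)`. -/
noncomputable def stepError (a : ℝ) (s : ℂ) : ℂ :=
  (a : ℂ) ^ (1 - s) - ((a + 1 : ℝ) : ℂ) ^ (1 - s) - (s - 1) * ((a + 1 : ℝ) : ℂ) ^ (-s)

theorem stepError_eq_integral {a : ℝ} (ha : 0 < a) (s : ℂ) :
    stepError a s = ∫ x in a..(a + 1), s * (s - 1) * ((x - a : ℝ) : ℂ) * (x : ℂ) ^ (-s - 1) := by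
  have hd : ∀ x ∈ uIcc a (a + 1), HasDerivAt
      (fun x : ℝ => -(s - 1) * ((x : ℂ) - a) * (x : ℂ) ^ (-s) - (x : ℂ) ^ (1 - s))
      (s * (s - 1) * ((x - a : ℝ) : ℂ) * (x : ℂ) ^ (-s - 1)) x := by
    intro x hx
    rw [uIcc_of_le (by linarith)] at hx
    have hx0 : 0 < x := ha.trans_le hx.1
    have hxc : (x : ℂ) ≠ 0 := ofReal_ne_zero.2 hx0.ne'
    have hs : (x : ℂ) ∈ slitPlane := ofReal_mem_slitPlane.2 hx0
    have h1 : HasDerivAt (fun x : ℂ => -(s - 1) * (x - a) * x ^ (-s) - x ^ (1 - s))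
        (-(s - 1) * 1 * (x : ℂ) ^ (-s) + -(s - 1) * (x - a) * (-s * (x : ℂ) ^ (-s - 1) * 1)
          - (1 - s) * (x : ℂ) ^ (1 - s - 1) * 1) (x : ℂ) := by
      refine HasDerivAt.sub (HasDerivAt.mul ?_ ((hasDerivAt_id _).cpow_const hs))
        ((hasDerivAt_id _).cpow_const hs)
      exact ((hasDerivAt_id _).sub_const _).const_mul _
    convert h1.comp_ofReal using 1
    rw [show 1 - s - 1 = -s by ring, cpow_sub _ _ hxc, cpow_one]
    push_cast
    field_simp
    ring
  rw [intervalIntegral.integral_eq_sub_of_hasDerivAt hd]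
  · simp [stepError]
    ring
  · apply ContinuousOn.intervalIntegrable
    intro x hx
    rw [uIcc_of_le (by linarith)] at hx
    have hs : (x : ℂ) ∈ slitPlane := ofReal_mem_slitPlane.2 (ha.trans_le hx.1)
    refine ContinuousAt.continuousWithinAt ?_
    exact (by fun_prop : ContinuousAt (fun x : ℝ => s * (s - 1) * ((x - a : ℝ) : ℂ)) x).mul
      (continuous_ofReal.continuousAt.cpow continuousAt_const hs)

/-- Chebyshev's inequality: x - a has mean 1/2 on the interval and is oppositely ordered to g. The
factor 1/2 is essential: the trivial x - a ≤ 1 would give only |s-1| ≥ Re s at a zero, which says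
nothing on the critical line. -/
theorem integral_sub_mul_le {a : ℝ} {g : ℝ → ℝ} (hg : ContinuousOn g (Icc a (a + 1)))
    (hm : AntitoneOn g (Icc a (a + 1))) :
    ∫ x in a..(a + 1), (x - a) * g x ≤ (∫ x in a..(a + 1), g x) / 2 := by
  have hg' : ContinuousOn g (uIcc a (a + 1)) := by rwa [uIcc_of_le (by linarith)]
  have hi : IntervalIntegrable g volume a (a + 1) := hg'.intervalIntegrable
  have hi2 : IntervalIntegrable (fun x => (x - a) * g x) volume a (a + 1) :=
    ((by fun_prop : ContinuousOn (fun x => x - a) (uIcc a (a + 1))).mul hg').intervalIntegrable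
  -- Pointwise, (x - a - 1/2)(g(x) - g(a + 1/2)) ≤ 0, since g is antitone.
  have key : ∫ x in a..(a + 1), ((x - a) * g x - 1 / 2 * g x) ≤
      ∫ x in a..(a + 1), (x - a - 1 / 2) * g (a + 1 / 2) := by
    refine intervalIntegral.integral_mono_on (by linarith) (hi2.sub (hi.const_mul _))
      (Continuous.intervalIntegrable (by fun_prop) _ _) fun x hx => ?_
    have hmid : a + 1 / 2 ∈ Icc a (a + 1) := ⟨by linarith, by linarith⟩
    rcases le_total x (a + 1 / 2) with h | h
    · nlinarith [hm hx hmid h]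
    · nlinarith [hm hmid hx h]
  have h0 : ∫ x in a..(a + 1), (x - a - 1 / 2) * g (a + 1 / 2) = 0 := by
    rw [intervalIntegral.integral_mul_const, intervalIntegral.integral_sub,
      intervalIntegral.integral_sub, integral_id]
    · simp
      left
      ring
    all_goals exact Continuous.intervalIntegrable (by fun_prop) _ _
  rw [h0, intervalIntegral.integral_sub hi2 (hi.const_mul _),
    intervalIntegral.integral_const_mul] at key
  linarith

theorem norm_stepError_le {a : ℝ} (ha : 0 < a) {s : ℂ} (hs : 0 < s.re) :
    ‖stepError a s‖ ≤ ‖s‖ * ‖s - 1‖ * ((∫ x in a..(a + 1), x ^ (-s.re - 1)) / 2) := by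
  have hpos : ∀ x ∈ Icc a (a + 1), 0 < x := fun x hx => ha.trans_le hx.1
  have hcont : ContinuousOn (fun x : ℝ => x ^ (-s.re - 1)) (Icc a (a + 1)) := fun x hx =>
    (Real.continuousAt_rpow_const _ _ (Or.inl (hpos x hx).ne')).continuousWithinAt
  have hanti : AntitoneOn (fun x : ℝ => x ^ (-s.re - 1)) (Icc a (a + 1)) := fun x hx y _ hxy =>
    Real.rpow_le_rpow_of_nonpos (hpos x hx) hxy (by linarith)
  calc ‖stepError a s‖
      ≤ ∫ x in a..(a + 1), ‖s‖ * ‖s - 1‖ * ((x - a) * x ^ (-s.re - 1)) := by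
        rw [stepError_eq_integral ha]
        refine intervalIntegral.norm_integral_le_of_norm_le (by linarith) ?_ ?_
        · refine ae_of_all _ fun x hx => ?_
          rw [norm_mul, norm_mul, norm_mul, norm_cpow_eq_rpow_re_of_pos (ha.trans hx.1), norm_real,
            Real.norm_of_nonneg (by linarith [hx.1])]
          simp [mul_assoc]
        · refine ContinuousOn.intervalIntegrable ?_
          rw [uIcc_of_le (by linarith)]
          fun_prop
    _ ≤ _ := by
        rw [intervalIntegral.integral_const_mul]
        gcongr
        exact integral_sub_mul_le hcont hanti

theorem integral_rpow_neg_sub_one {a : ℝ} (ha : 0 < a) {σ : ℝ} (hσ : 0 < σ) :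
    ∫ x in a..(a + 1), x ^ (-σ - 1) = (a ^ (-σ) - (a + 1) ^ (-σ)) / σ := by
  rw [integral_rpow (Or.inr ⟨by linarith, notMem_uIcc_of_lt ha (by linarith)⟩)]
  rw [show -σ - 1 + 1 = -σ by ring, div_neg, ← neg_div]
  ring

/-- This form telescopes over a = 1, 2, …, which keeps the sharp constant in the sum. -/
theorem norm_stepError_le_sub {a : ℝ} (ha : 0 < a) {s : ℂ} (hs : 0 < s.re) :
    ‖stepError a s‖ ≤
      ‖s‖ * ‖s - 1‖ / (2 * s.re) * (a ^ (-s.re) - (a + 1) ^ (-s.re)) := by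
  refine (norm_stepError_le ha hs).trans_eq ?_
  rw [integral_rpow_neg_sub_one ha hs]
  field_simp

/-- Cruder than the telescoping bound, but it gives a summable majorant that is locally uniform in
s. -/
theorem norm_stepError_le_rpow {a : ℝ} (ha : 0 < a) {s : ℂ} (hs : 0 < s.re) :
    ‖stepError a s‖ ≤ ‖s‖ * ‖s - 1‖ * a ^ (-s.re - 1) := by
  refine (norm_stepError_le ha hs).trans ?_
  gcongr
  have h : ∫ x in a..(a + 1), x ^ (-s.re - 1) ≤ ∫ x in a..(a + 1), a ^ (-s.re - 1) := by
    refine intervalIntegral.integral_mono_on (by linarith) ?_ (by simp) fun x hx =>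
      Real.rpow_le_rpow_of_nonpos ha hx.1 (by linarith)
    exact intervalIntegral.intervalIntegrable_rpow (Or.inr (notMem_uIcc_of_lt ha (by linarith)))
  simp at h
  have : 0 < a ^ (-s.re - 1) := by positivity
  linarith

theorem differentiable_stepError {a : ℝ} (ha : 0 < a) : Differentiable ℂ (stepError a) := by
  have h1 : (a : ℂ) ≠ 0 := ofReal_ne_zero.2 ha.ne'
  have h2 : ((a + 1 : ℝ) : ℂ) ≠ 0 := ofReal_ne_zero.2 (by linarith)
  unfold stepError
  intro s
  refine DifferentiableAt.sub (DifferentiableAt.sub ?_ ?_) (DifferentiableAt.mul (by fun_prop) ?_)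
  · exact DifferentiableAt.const_cpow (by fun_prop) (Or.inl h1)
  · exact DifferentiableAt.const_cpow (by fun_prop) (Or.inl h2)
  · exact DifferentiableAt.const_cpow (by fun_prop) (Or.inl h2)

/-- The powers with exponent 1 - s telescope. The leading s is 1 + (s - 1): the step errors begin
with the term 2^(-s), and the s - 1 supplies the missing term 1^(-s). -/
theorem sum_stepError (N : ℕ) (s : ℂ) :
    ∑ k ∈ Finset.range N, stepError (k + 1) s =
      s - ((N : ℂ) + 1) ^ (1 - s) -
        (s - 1) * ∑ k ∈ Finset.range (N + 1), 1 / ((k : ℂ) + 1) ^ s := by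
  induction N with
  | zero => simp
  | succ N ih =>
    rw [Finset.sum_range_succ, ih, Finset.sum_range_succ _ (N + 1), stepError]
    push_cast
    rw [cpow_neg]
    ring

theorem norm_sum_stepError_le (N : ℕ) {s : ℂ} (hs : 0 < s.re) :
    ‖∑ k ∈ Finset.range N, stepError (k + 1) s‖ ≤ ‖s‖ * ‖s - 1‖ / (2 * s.re) := by
  have h : ∑ k ∈ Finset.range N, (((k : ℝ) + 1) ^ (-s.re) - ((k : ℝ) + 1 + 1) ^ (-s.re)) =
      1 - ((N : ℝ) + 1) ^ (-s.re) := by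
    have := Finset.sum_range_sub' (fun k : ℕ => ((k : ℝ) + 1) ^ (-s.re)) N
    simpa using this
  calc _ ≤ ∑ k ∈ Finset.range N, ‖s‖ * ‖s - 1‖ / (2 * s.re) *
        (((k : ℝ) + 1) ^ (-s.re) - ((k : ℝ) + 1 + 1) ^ (-s.re)) :=
        norm_sum_le_of_le _ fun k _ => norm_stepError_le_sub (by positivity) hs
    _ = ‖s‖ * ‖s - 1‖ / (2 * s.re) * (1 - ((N : ℝ) + 1) ^ (-s.re)) := by
        rw [← Finset.mul_sum, h]
    _ ≤ ‖s‖ * ‖s - 1‖ / (2 * s.re) * 1 := by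
        gcongr
        have : 0 < ((N : ℝ) + 1) ^ (-s.re) := by positivity
        linarith
    _ = _ := mul_one _

theorem summable_natCast_add_one_rpow {σ : ℝ} (hσ : 0 < σ) :
    Summable fun k : ℕ => ((k : ℝ) + 1) ^ (-σ - 1) := by
  have := (summable_nat_add_iff 1).2 (Real.summable_nat_rpow.2 (by linarith : -σ - 1 < -1))
  simpa using this

theorem summable_stepError {s : ℂ} (hs : 0 < s.re) :
    Summable fun k : ℕ => stepError (k + 1) s :=
  Summable.of_norm_bounded ((summable_natCast_add_one_rpow hs).mul_left (‖s‖ * ‖s - 1‖)) fun k =>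
    norm_stepError_le_rpow (by positivity) hs

theorem norm_tsum_stepError_le {s : ℂ} (hs : 0 < s.re) :
    ‖∑' k : ℕ, stepError (k + 1) s‖ ≤ ‖s‖ * ‖s - 1‖ / (2 * s.re) :=
  le_of_tendsto (summable_stepError hs).hasSum.tendsto_sum_nat.norm
    (Eventually.of_forall fun N => norm_sum_stepError_le N hs)

theorem differentiableOn_tsum_stepError :
    DifferentiableOn ℂ (fun s => ∑' k : ℕ, stepError (k + 1) s) {s | 0 < s.re} := by
  intro s (hs : 0 < s.re)
  set U : Set ℂ := {z | s.re / 2 < z.re} ∩ Metric.ball 0 (‖s‖ + 1)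
  have hU : IsOpen U := (isOpen_lt continuous_const continuous_re).inter Metric.isOpen_ball
  have hsU : s ∈ U := ⟨by simp; linarith, by simp⟩
  have hd : DifferentiableOn ℂ (fun s => ∑' k : ℕ, stepError (k + 1) s) U := by
    refine differentiableOn_tsum_of_summable_norm
      ((summable_natCast_add_one_rpow (half_pos hs)).mul_left ((‖s‖ + 1) * (‖s‖ + 1 + 1)))
      (fun k => (differentiable_stepError (by positivity)).differentiableOn) hU fun k z hz => ?_
    have hz1 : s.re / 2 < z.re := hz.1
    have hz2 : ‖z‖ < ‖s‖ + 1 := by simpa using hz.2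
    refine (norm_stepError_le_rpow (by positivity) (by linarith)).trans ?_
    gcongr
    · exact (norm_sub_le _ _).trans (by simpa using hz2.le)
    · linarith [k.cast_nonneg (α := ℝ)]
  exact (hd.differentiableAt (hU.mem_nhds hsU)).differentiableWithinAt

theorem tsum_stepError_of_one_lt_re {s : ℂ} (hs : 1 < s.re) :
    ∑' k : ℕ, stepError (k + 1) s = s - riemannZeta₁ s := by
  have hs1 : s ≠ 1 := fun h => by simp [h] at hs
  have hz : riemannZeta₁ s = (s - 1) * riemannZeta s := by
    rw [riemannZeta_eq_inv_sub_mul hs1, mul_inv_cancel_left₀ (sub_ne_zero.2 hs1)]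
  have h1 := (summable_stepError (by linarith : 0 < s.re)).hasSum.tendsto_sum_nat
  refine tendsto_nhds_unique h1 ?_
  simp_rw [sum_stepError]
  have hsum : Summable fun k : ℕ => 1 / ((k : ℂ) + 1) ^ s := by
    have := (summable_nat_add_iff 1).2 (Complex.summable_one_div_nat_cpow.2 hs)
    simpa using this
  have h2 := ((hsum.hasSum.tendsto_sum_nat.comp (tendsto_add_atTop_nat 1)).const_mul (s - 1))
  rw [← zeta_eq_tsum_one_div_nat_add_one_cpow hs, ← hz] at h2
  have h3 : Tendsto (fun N : ℕ => ((N : ℂ) + 1) ^ (1 - s)) atTop (𝓝 0) := by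
    rw [tendsto_zero_iff_norm_tendsto_zero]
    have : Tendsto (fun N : ℕ => ((N : ℝ) + 1) ^ (-(s.re - 1))) atTop (𝓝 0) :=
      (tendsto_rpow_neg_atTop (by linarith)).comp
        (tendsto_atTop_add_const_right _ _ tendsto_natCast_atTop_atTop)
    refine this.congr fun N => ?_
    have := norm_cpow_eq_rpow_re_of_pos (by positivity : (0 : ℝ) < N + 1) (1 - s)
    push_cast at this
    rw [this]
    simp
  simpa using (h3.const_sub s).sub h2

/-- Both sides are analytic on Re s > 0 and agree near 2, where the Dirichlet series converges. -/
theorem tsum_stepError {s : ℂ} (hs : 0 < s.re) :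
    ∑' k : ℕ, stepError (k + 1) s = s - riemannZeta₁ s := by
  have hU : IsOpen {s : ℂ | 0 < s.re} := isOpen_lt continuous_const continuous_re
  refine AnalyticOnNhd.eqOn_of_preconnected_of_eventuallyEq
    (differentiableOn_tsum_stepError.analyticOnNhd hU)
    ((differentiable_id.sub differentiable_riemannZeta₁).differentiableOn.analyticOnNhd hU)
    (convex_halfSpace_re_gt 0).isPreconnected (z₀ := 2) (by simp) ?_ hs
  filter_upwards [(isOpen_lt continuous_const continuous_re : IsOpen {s : ℂ | 1 < s.re}).mem_nhds
    (by simp : (2 : ℂ) ∈ {s : ℂ | 1 < s.re})] with z hz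
  exact tsum_stepError_of_one_lt_re hz

theorem norm_sub_riemannZeta₁_le {s : ℂ} (hs : 0 < s.re) :
    ‖s - riemannZeta₁ s‖ ≤ ‖s‖ * ‖s - 1‖ / (2 * s.re) := by
  rw [← tsum_stepError hs]
  exact norm_tsum_stepError_le hs

/-! ### The completed zeta function and the absence of low zeros -/

/-- The entire function `s (1 - s) Λ(s)`. -/
noncomputable def xiFun (s : ℂ) : ℂ := s * (1 - s) * completedRiemannZeta₀ s - 1

theorem differentiable_xiFun : Differentiable ℂ xiFun := by
  have := differentiable_completedZeta₀
  unfold xiFun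
  fun_prop

theorem xiFun_one_sub (s : ℂ) : xiFun (1 - s) = xiFun s := by
  rw [xiFun, xiFun, completedRiemannZeta₀_one_sub]
  ring

theorem xiFun_zero : xiFun 0 = -1 := by simp [xiFun]

theorem xiFun_eq_completedRiemannZeta {s : ℂ} (h0 : s ≠ 0) (h1 : s ≠ 1) :
    xiFun s = s * (1 - s) * completedRiemannZeta s := by
  have h1' : 1 - s ≠ 0 := sub_ne_zero.2 h1.symm
  rw [completedRiemannZeta_eq, xiFun]
  field_simp
  ring

theorem xiFun_mul_inv_Gammaℝ {s : ℂ} (h0 : s ≠ 0) (h1 : s ≠ 1) :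
    xiFun s * (Gammaℝ s)⁻¹ = s * (1 - s) * riemannZeta s := by
  rw [xiFun_eq_completedRiemannZeta h0 h1, riemannZeta_def_of_ne_zero h0]
  ring

theorem Gammaℝ_ne_zero_of_im_ne_zero {s : ℂ} (hs : s.im ≠ 0) : Gammaℝ s ≠ 0 := by
  rw [Ne, Gammaℝ_eq_zero_iff]
  rintro ⟨n, rfl⟩
  simp at hs

theorem riemannZeta_one_sub_eq_zero {s : ℂ} (hs : s.im ≠ 0) (h : riemannZeta s = 0) :
    riemannZeta (1 - s) = 0 := by
  have h0 : s ≠ 0 := fun h => by simp [h] at hs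
  have h1 : 1 - s ≠ 0 := fun h => hs (by simpa using (congrArg im h))
  rw [riemannZeta_def_of_ne_zero h0, div_eq_zero_iff] at h
  rw [riemannZeta_def_of_ne_zero h1, completedRiemannZeta_one_sub,
    h.resolve_right (Gammaℝ_ne_zero_of_im_ne_zero hs), zero_div]

theorem re_pos_of_riemannZeta_eq_zero {s : ℂ} (hs : s.im ≠ 0) (h : riemannZeta s = 0) :
    0 < s.re := by
  by_contra! hre
  exact riemannZeta_ne_zero_of_one_le_re (s := 1 - s) (by simpa using hre)
    (riemannZeta_one_sub_eq_zero hs h)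

theorem re_lt_one_of_riemannZeta_eq_zero {s : ℂ} (h : riemannZeta s = 0) : s.re < 1 := by
  by_contra! hre
  exact riemannZeta_ne_zero_of_one_le_re hre h

/-- At a zero the bound for s - (s-1)ζ(s) reads |s| ≤ |s||s-1|/(2 Re s), so |s-1| ≥ 2 Re s ≥ 1.
Since 1 - Re s lies in (0, 1/2], its square uses up at most 1/4. -/
theorem im_sq_ge_of_half_le_re {s : ℂ} (hs : s.im ≠ 0) (hre : 1 / 2 ≤ s.re)
    (h : riemannZeta s = 0) : 3 / 4 ≤ s.im ^ 2 := by
  have h1 : s ≠ 1 := fun h => by simp [h] at hs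
  have h0 : s ≠ 0 := fun h => by simp [h] at hs
  have hz : riemannZeta₁ s = 0 := by
    rw [riemannZeta_eq_inv_sub_mul h1, mul_eq_zero] at h
    exact h.resolve_left (inv_ne_zero (sub_ne_zero.2 h1))
  have hle := norm_sub_riemannZeta₁_le (by linarith : 0 < s.re)
  rw [hz, sub_zero, mul_div_assoc] at hle
  have hn : 1 ≤ ‖s - 1‖ / (2 * s.re) := by
    by_contra! hlt
    nlinarith [norm_pos_iff.2 h0]
  rw [le_div_iff₀ (by linarith)] at hn
  have h2 : 1 ≤ ‖s - 1‖ ^ 2 := by nlinarith [norm_nonneg (s - 1)]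
  rw [Complex.sq_norm, Complex.normSq_apply] at h2
  simp at h2
  nlinarith [re_lt_one_of_riemannZeta_eq_zero h]

theorem im_sq_ge_of_riemannZeta_eq_zero {s : ℂ} (hs : s.im ≠ 0) (h : riemannZeta s = 0) :
    3 / 4 ≤ s.im ^ 2 := by
  rcases le_total (1 / 2) s.re with hre | hre
  · exact im_sq_ge_of_half_le_re hs hre h
  · have := im_sq_ge_of_half_le_re (s := 1 - s) (by simpa using hs) (by simp; linarith)
      (riemannZeta_one_sub_eq_zero hs h)
    simpa using this

/-! ### Growth of s(1-s)Λ(s) -/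

theorem norm_Gamma_le {s : ℂ} (hs : 0 < s.re) : ‖Gamma s‖ ≤ Real.Gamma s.re := by
  rw [Gamma_eq_integral hs, Real.Gamma_eq_integral hs, GammaIntegral]
  refine norm_integral_le_of_norm_le (Real.GammaIntegral_convergent hs) ?_
  refine (ae_restrict_iff' measurableSet_Ioi).2 (ae_of_all _ fun x (hx : 0 < x) => ?_)
  rw [norm_mul, norm_cpow_eq_rpow_re_of_pos hx, norm_real, Real.norm_of_nonneg (Real.exp_nonneg _)]
  simp

theorem realGamma_le_exp {x : ℝ} (hx : 1 / 4 ≤ x) : Real.Gamma x ≤ 4 * Real.exp ((x + 2) ^ 2) := by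
  have h1 : Real.Gamma (x + 2) = (x + 1) * (x * Real.Gamma x) := by
    rw [← Real.Gamma_add_one (by linarith), ← Real.Gamma_add_one (by linarith)]
    ring_nf
  have hG : 0 < Real.Gamma x := Real.Gamma_pos_of_pos (by linarith)
  -- For x ≥ 1/4, x(x+1) ≥ 5/16 > 1/4. The shift by 2 reaches the range where Γ is increasing.
  have h2 : Real.Gamma x ≤ 4 * Real.Gamma (x + 2) := by
    rw [h1]
    have h := mul_nonneg hG.le (by linarith : (0 : ℝ) ≤ x - 1 / 4)
    nlinarith [mul_nonneg h (by linarith : (0 : ℝ) ≤ x)]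
  set n := ⌈x⌉₊
  have hn : x ≤ n := Nat.le_ceil x
  have hn' : (n : ℝ) < x + 1 := Nat.ceil_lt_add_one (by linarith)
  have h3 : Real.Gamma (x + 2) ≤ Real.Gamma ((n + 1 : ℕ) + 1) :=
    Real.Gamma_strictMonoOn_Ici.monotoneOn (by simp; linarith)
      (by simp; linarith) (by push_cast; linarith)
  rw [Real.Gamma_nat_eq_factorial] at h3
  have h4 : ((n + 1).factorial : ℝ) ≤ ((n + 1 : ℕ) : ℝ) ^ (n + 1) := by
    exact_mod_cast Nat.factorial_le_pow _
  have h5 : ((n + 1 : ℕ) : ℝ) ^ (n + 1) ≤ Real.exp ((n + 1 : ℕ) : ℝ) ^ (n + 1) := by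
    gcongr
    linarith [Real.add_one_le_exp ((n + 1 : ℕ) : ℝ)]
  rw [← Real.exp_nat_mul] at h5
  have h6 : Real.exp (((n + 1 : ℕ) : ℝ) * ((n + 1 : ℕ) : ℝ)) ≤ Real.exp ((x + 2) ^ 2) := by
    apply Real.exp_le_exp.2
    push_cast
    nlinarith
  linarith

/-- Away from s = 1 the function equals -s · `Gammaℝ s` · (s-1)ζ(s), and each factor has an
elementary bound. The quadratic exponent is far from sharp, but any polynomial count of zeros
suffices. -/
theorem norm_xiFun_le_of_half_le_re {s : ℂ} (hs : 1 / 2 ≤ s.re) :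
    ‖xiFun s‖ ≤ Real.exp (10 * (2 + ‖s‖) ^ 2) := by
  by_cases h1 : s = 1
  · subst h1
    simp [xiFun]
    norm_num
  have h0 : s ≠ 0 := fun h => by simp [h] at hs; linarith
  set r := ‖s‖
  have hr : 0 ≤ r := norm_nonneg s
  have hre : s.re ≤ r := re_le_norm s
  have hz : ‖riemannZeta₁ s‖ ≤ r + r * (1 + r) := by
    have h := norm_sub_riemannZeta₁_le (by linarith : 0 < s.re)
    have h2 : ‖s‖ * ‖s - 1‖ / (2 * s.re) ≤ r * (1 + r) := by
      rw [div_le_iff₀ (by linarith)]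
      have : ‖s - 1‖ ≤ 1 + r := (norm_sub_le _ _).trans (by simp [r, add_comm])
      have h3 : r * ‖s - 1‖ ≤ r * (1 + r) := by gcongr
      have h4 : 0 ≤ r * (1 + r) := by positivity
      nlinarith
    have h3 : ‖riemannZeta₁ s‖ ≤ ‖s‖ + ‖s - riemannZeta₁ s‖ := by
      have := norm_sub_le s (s - riemannZeta₁ s)
      simpa using this
    linarith
  have hG : ‖Gammaℝ s‖ ≤ 4 * Real.exp ((r + 2) ^ 2) := by
    rw [Gammaℝ_def, norm_mul, norm_cpow_eq_rpow_re_of_pos Real.pi_pos]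
    have e1 : (s / 2).re = s.re / 2 := by simp
    have e2 : (-s / 2).re = -(s.re / 2) := by simp [neg_div]
    have h2 : Real.pi ^ (-s / 2).re ≤ 1 := by
      rw [e2]
      exact Real.rpow_le_one_of_one_le_of_nonpos (by linarith [Real.pi_gt_three]) (by linarith)
    have h3 : ‖Gamma (s / 2)‖ ≤ 4 * Real.exp ((r + 2) ^ 2) := by
      refine (norm_Gamma_le (by rw [e1]; linarith)).trans
        ((realGamma_le_exp (by rw [e1]; linarith)).trans ?_)
      rw [e1]
      gcongr
      linarith
    calc _ ≤ 1 * (4 * Real.exp ((r + 2) ^ 2)) := by gcongr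
      _ = _ := one_mul _
  have hx : xiFun s = -(s * Gammaℝ s * riemannZeta₁ s) := by
    have hG0 : Gammaℝ s ≠ 0 := Gammaℝ_ne_zero_of_re_pos (by linarith)
    have hzeta : riemannZeta₁ s = (s - 1) * riemannZeta s := by
      rw [riemannZeta_eq_inv_sub_mul h1, mul_inv_cancel_left₀ (sub_ne_zero.2 h1)]
    have := xiFun_mul_inv_Gammaℝ h0 h1
    rw [mul_inv_eq_iff_eq_mul₀ hG0] at this
    rw [this, hzeta]
    ring
  rw [hx, norm_neg, norm_mul, norm_mul]
  have he : r + 2 ≤ Real.exp (r + 2) := by linarith [Real.add_one_le_exp (r + 2)]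
  have he4 : (4 : ℝ) ≤ Real.exp (r + 2) ^ 2 := by nlinarith
  calc ‖s‖ * ‖Gammaℝ s‖ * ‖riemannZeta₁ s‖
      ≤ r * (4 * Real.exp ((r + 2) ^ 2)) * (r + r * (1 + r)) := by gcongr
    _ ≤ (r + 2) * (Real.exp (r + 2) ^ 2 * Real.exp ((r + 2) ^ 2)) * (r + 2) ^ 2 := by
        gcongr
        · linarith
        · nlinarith
    _ ≤ Real.exp (r + 2) * (Real.exp (r + 2) ^ 2 * Real.exp ((r + 2) ^ 2)) *
          Real.exp (r + 2) ^ 2 := by gcongr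
    _ = Real.exp (5 * (r + 2) + (r + 2) ^ 2) := by
        rw [← Real.exp_nat_mul, ← Real.exp_add, ← Real.exp_add, ← Real.exp_add]
        congr 1
        push_cast
        ring
    _ ≤ _ := by
        apply Real.exp_le_exp.2
        nlinarith

theorem norm_xiFun_le (s : ℂ) : ‖xiFun s‖ ≤ Real.exp (10 * (3 + ‖s‖) ^ 2) := by
  rcases le_total (1 / 2) s.re with hs | hs
  · refine (norm_xiFun_le_of_half_le_re hs).trans ?_
    gcongr
    norm_num
  · rw [← xiFun_one_sub]
    refine (norm_xiFun_le_of_half_le_re (by simp; linarith)).trans ?_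
    gcongr 3
    have : ‖1 - s‖ ≤ 1 + ‖s‖ := (norm_sub_le _ _).trans (by simp)
    linarith

/-! ### Counting zeros with multiplicity -/

/-- Off the real axis neither s(1-s) nor 1/`Gammaℝ s` vanishes, so multiplicities are unchanged. -/
theorem analyticOrderAt_xiFun {s : ℂ} (hs : s.im ≠ 0) :
    analyticOrderAt xiFun s = analyticOrderAt riemannZeta s := by
  have h1 : s ≠ 1 := fun h => by simp [h] at hs
  have h0 : s ≠ 0 := fun h => by simp [h] at hs
  have hev : (fun z => xiFun z * (Gammaℝ z)⁻¹) =ᶠ[𝓝 s]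
      (fun z => z * (1 - z) * riemannZeta z) := by
    filter_upwards [isOpen_ne.mem_nhds h0, isOpen_ne.mem_nhds h1] with z hz0 hz1
    exact xiFun_mul_inv_Gammaℝ hz0 hz1
  have hG : AnalyticAt ℂ (fun z => (Gammaℝ z)⁻¹) s := differentiable_Gammaℝ_inv.analyticAt s
  have hx : AnalyticAt ℂ xiFun s := differentiable_xiFun.analyticAt s
  have hζ : AnalyticAt ℂ riemannZeta s := analyticOn_riemannZeta s h1
  have hp : AnalyticAt ℂ (fun z : ℂ => z * (1 - z)) s := by fun_prop
  have h := analyticOrderAt_congr hev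
  have e1 := analyticOrderAt_mul hx hG
  have e2 := analyticOrderAt_mul hp hζ
  rw [hG.analyticOrderAt_eq_zero.2 (inv_ne_zero (Gammaℝ_ne_zero_of_im_ne_zero hs)), add_zero] at e1
  rw [hp.analyticOrderAt_eq_zero.2 (mul_ne_zero h0 (sub_ne_zero.2 h1.symm)), zero_add] at e2
  rw [← e1, ← e2]
  exact h

theorem divisor_xiFun {r : ℝ} {s : ℂ} (hs : s.im ≠ 0) (hr : s ∈ Metric.closedBall 0 r) :
    MeromorphicOn.divisor xiFun (Metric.closedBall 0 r) s = analyticOrderNatAt riemannZeta s := by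
  have h : AnalyticOnNhd ℂ xiFun (Metric.closedBall 0 r) := fun z _ =>
    differentiable_xiFun.analyticAt z
  rw [MeromorphicOn.AnalyticOnNhd.divisor_apply h hr, analyticOrderAt_xiFun hs, analyticOrderNatAt]
  -- An infinite order would count as 0 on both sides.
  cases analyticOrderAt riemannZeta s <;> rfl

/-- Jensen's inequality for the radii r and 2r, normalized by the value -1 at the origin. -/
theorem finsum_divisor_xiFun_le {r : ℝ} (hr : 0 < r) :
    (∑ᶠ u, MeromorphicOn.divisor xiFun (Metric.closedBall 0 r) u : ℤ) ≤
      10 / Real.log 2 * (3 + 2 * r) ^ 2 := by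
  have h := AnalyticOnNhd.sum_divisor_le (c := 0) (r := r) (R := 2 * r)
    (M := Real.exp (10 * (3 + 2 * r) ^ 2)) (f := xiFun) (by positivity)
    (by rw [abs_of_pos hr, abs_of_pos (by positivity)]; linarith)
    (Real.one_le_exp (by positivity)) (fun z _ => differentiable_xiFun.analyticAt z)
    (by simp [xiFun_zero]) (fun z hz => ?_)
  · rw [abs_of_pos hr, xiFun_zero, norm_neg, norm_one, div_one, Real.log_exp,
      mul_div_cancel_right₀ _ hr.ne'] at h
    refine h.trans_eq ?_
    ring
  · have hz' : ‖z‖ = 2 * r := by simpa [abs_of_pos hr] using hz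
    simpa [hz'] using norm_xiFun_le z

theorem exists_finset_zeroIndex {r : ℝ} (hr : 0 < r) : ∃ T : Finset ZeroIndex,
    (∀ i : ZeroIndex, ‖i.zero‖ ≤ r → i ∈ T) ∧
      (T.card : ℝ) ≤ 10 / Real.log 2 * (3 + 2 * r) ^ 2 := by
  have hfin : {ρ : UpperZero | ‖ρ.1‖ ≤ r}.Finite := by
    refine Set.Finite.of_finite_image (f := Subtype.val) ?_ Subtype.val_injective.injOn
    refine ((isCompact_closedBall (0 : ℂ) r).inter_riemannZetaZeros_finite).subset ?_
    rintro _ ⟨ρ, hρ, rfl⟩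
    exact ⟨by simpa using hρ, ρ.2.1⟩
  refine ⟨hfin.toFinset.sigma fun _ => Finset.univ, fun i hi => ?_, ?_⟩
  · exact Finset.mem_sigma.2 ⟨hfin.mem_toFinset.2 hi, Finset.mem_univ _⟩
  · refine le_trans ?_ (finsum_divisor_xiFun_le hr)
    have hcard : (hfin.toFinset.sigma fun ρ =>
        (Finset.univ : Finset (Fin (analyticOrderNatAt riemannZeta ρ.1)))).card =
          ∑ ρ ∈ hfin.toFinset, analyticOrderNatAt riemannZeta ρ.1 := by
      rw [Finset.card_sigma]
      simp
    refine (Nat.cast_le.2 hcard.le).trans ?_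
    have hD := (MeromorphicOn.divisor xiFun (Metric.closedBall 0 r)).finiteSupport
      (isCompact_closedBall 0 r)
    have hnn : 0 ≤ MeromorphicOn.divisor xiFun (Metric.closedBall 0 r) :=
      MeromorphicOn.AnalyticOnNhd.divisor_nonneg fun z _ => differentiable_xiFun.analyticAt z
    have key : ((∑ ρ ∈ hfin.toFinset, analyticOrderNatAt riemannZeta ρ.1 : ℕ) : ℤ) ≤
        ∑ᶠ u, MeromorphicOn.divisor xiFun (Metric.closedBall 0 r) u := by
      classical
      calc ((∑ ρ ∈ hfin.toFinset, analyticOrderNatAt riemannZeta ρ.1 : ℕ) : ℤ)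
          = ∑ ρ ∈ hfin.toFinset, MeromorphicOn.divisor xiFun (Metric.closedBall 0 r) ρ.1 := by
            push_cast
            refine Finset.sum_congr rfl fun ρ hρ => (divisor_xiFun ρ.2.2.ne' ?_).symm
            simpa using hfin.mem_toFinset.1 hρ
        _ = ∑ u ∈ hfin.toFinset.image Subtype.val,
              MeromorphicOn.divisor xiFun (Metric.closedBall 0 r) u :=
            (Finset.sum_image Subtype.val_injective.injOn).symm
        _ ≤ ∑ u ∈ hfin.toFinset.image Subtype.val ∪ hD.toFinset,
              MeromorphicOn.divisor xiFun (Metric.closedBall 0 r) u :=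
            Finset.sum_le_sum_of_subset_of_nonneg Finset.subset_union_left fun u _ _ => hnn u
        _ = _ := (finsum_eq_sum_of_support_subset _ (by
            intro u hu
            simp only [Finset.coe_union, Set.mem_union]
            exact Or.inr (hD.mem_toFinset.2 hu))).symm
    exact_mod_cast key

/-- Group the indices by n = ⌊ν⌋: a group has at most C(n+3)² members, each contributing at most
exp(-xn) because ν² ≥ n² ≥ n. -/
theorem summable_exp_neg_mul_sq {ι : Type*} {ν : ι → ℝ} (hν : ∀ i, 0 ≤ ν i) {C : ℝ}
    (hT : ∀ n : ℕ, ∃ T : Finset ι, (∀ i, ν i ≤ n + 1 → i ∈ T) ∧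
      (T.card : ℝ) ≤ C * ((n : ℝ) + 3) ^ 2) {x : ℝ} (hx : 0 < x) :
    Summable fun i => Real.exp (-x * ν i ^ 2) := by
  classical
  choose T hT1 hT2 using hT
  have hsum : Summable fun n : ℕ => C * ((n : ℝ) + 3) ^ 2 * Real.exp (-x * n) := by
    have h := (summable_nat_add_iff 3).2 (Real.summable_pow_mul_exp_neg_nat_mul 2 hx)
    refine (h.mul_left (C * Real.exp (3 * x))).congr fun n => ?_
    push_cast
    rw [show -x * n = 3 * x + -x * (n + 3) by ring, Real.exp_add]
    ring
  have hnn : ∀ n : ℕ, 0 ≤ C * ((n : ℝ) + 3) ^ 2 * Real.exp (-x * n) := fun n =>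
    mul_nonneg ((Nat.cast_nonneg _).trans (hT2 n)) (Real.exp_nonneg _)
  refine summable_of_sum_le (c := ∑' n : ℕ, C * ((n : ℝ) + 3) ^ 2 * Real.exp (-x * n))
    (fun i => Real.exp_nonneg _) fun F => ?_
  rw [← Finset.sum_fiberwise_of_maps_to (t := F.image fun i => ⌊ν i⌋₊)
    fun i hi => Finset.mem_image_of_mem _ hi]
  refine le_trans (Finset.sum_le_sum fun n _ => ?_) (hsum.sum_le_tsum _ fun n _ => hnn n)
  calc ∑ i ∈ F with ⌊ν i⌋₊ = n, Real.exp (-x * ν i ^ 2)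
      ≤ ∑ i ∈ F with ⌊ν i⌋₊ = n, Real.exp (-x * n) := by
        refine Finset.sum_le_sum fun i hi => Real.exp_le_exp.2 ?_
        have hn : (n : ℝ) ≤ ν i := by
          rw [← (Finset.mem_filter.1 hi).2]
          exact Nat.floor_le (hν i)
        have hn2 : (n : ℝ) ≤ (n : ℝ) ^ 2 := by exact_mod_cast Nat.le_self_pow two_ne_zero n
        have : (n : ℝ) ≤ ν i ^ 2 := hn2.trans (by gcongr)
        nlinarith
    _ ≤ ∑ i ∈ T n, Real.exp (-x * n) := by
        refine Finset.sum_le_sum_of_subset_of_nonneg (fun i hi => hT1 n i ?_)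
          fun _ _ _ => Real.exp_nonneg _
        rw [← (Finset.mem_filter.1 hi).2]
        exact (Nat.lt_floor_add_one _).le
    _ ≤ _ := by
        rw [Finset.sum_const, nsmul_eq_mul]
        gcongr
        exact hT2 n

theorem summable_exp_neg_norm_zero_sq {x : ℝ} (hx : 0 < x) :
    Summable fun i : ZeroIndex => Real.exp (-x * ‖i.zero‖ ^ 2) := by
  refine summable_exp_neg_mul_sq (fun i => norm_nonneg _) (C := 10 / Real.log 2 * 4)
    (fun n => ?_) hx
  obtain ⟨T, h1, h2⟩ := exists_finset_zeroIndex (r := n + 1) (by positivity)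
  refine ⟨T, h1, h2.trans ?_⟩
  have hlog : 0 ≤ 10 / Real.log 2 := div_nonneg (by norm_num) (Real.log_nonneg (by norm_num))
  rw [mul_assoc]
  refine mul_le_mul_of_nonneg_left ?_ hlog
  -- (3 + 2(n+1))² = (2n+5)² ≤ 4(n+3)².
  nlinarith [n.cast_nonneg (α := ℝ)]

/-! ### The real part of α² and convergence of f -/

theorem ZeroIndex.alpha_re (i : ZeroIndex) : i.alpha.re = i.zero.im := by
  rw [i.zero_eq]
  simp

theorem ZeroIndex.alpha_im (i : ZeroIndex) : i.alpha.im = 1 / 2 - i.zero.re := by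
  rw [i.zero_eq]
  simp

theorem ZeroIndex.alpha_re_pos (i : ZeroIndex) : 0 < i.alpha.re := by
  rw [i.alpha_re]
  exact i.1.2.2

theorem ZeroIndex.alpha_sq_re (i : ZeroIndex) :
    (i.alpha ^ 2).re = i.zero.im ^ 2 - (1 / 2 - i.zero.re) ^ 2 := by
  rw [sq, mul_re, i.alpha_re, i.alpha_im]
  ring

theorem ZeroIndex.half_le_alpha_sq_re (i : ZeroIndex) : 1 / 2 ≤ (i.alpha ^ 2).re := by
  have h1 := im_sq_ge_of_riemannZeta_eq_zero i.1.2.2.ne' i.1.2.1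
  have h2 := re_pos_of_riemannZeta_eq_zero i.1.2.2.ne' i.1.2.1
  have h3 := re_lt_one_of_riemannZeta_eq_zero i.1.2.1
  rw [i.alpha_sq_re, ZeroIndex.zero]
  nlinarith

/-- The difference |ρ|² - Re α² is σ² + (1/2 - σ)², at most 5/4 for 0 < σ < 1. -/
theorem ZeroIndex.norm_zero_sq_le (i : ZeroIndex) : ‖i.zero‖ ^ 2 ≤ (i.alpha ^ 2).re + 5 / 4 := by
  have h2 := re_pos_of_riemannZeta_eq_zero i.1.2.2.ne' i.1.2.1
  have h3 := re_lt_one_of_riemannZeta_eq_zero i.1.2.1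
  rw [i.alpha_sq_re, Complex.sq_norm, normSq_apply, ZeroIndex.zero]
  nlinarith

theorem summable_exp_neg_alpha_sq_re {x : ℝ} (hx : 0 < x) :
    Summable fun i : ZeroIndex => Real.exp (-(i.alpha ^ 2).re * x) := by
  refine Summable.of_nonneg_of_le (fun _ => Real.exp_nonneg _) (fun i => ?_)
    ((summable_exp_neg_norm_zero_sq hx).mul_left (Real.exp (5 / 4 * x)))
  rw [← Real.exp_add]
  apply Real.exp_le_exp.2
  nlinarith [i.norm_zero_sq_le]

theorem norm_exp_neg_alpha_sq_mul (i : ZeroIndex) (x : ℝ) :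
    ‖exp (-i.alpha ^ 2 * x)‖ = Real.exp (-(i.alpha ^ 2).re * x) := by
  rw [norm_exp]
  simp

/-- A summable family of nonzero terms has a countable index set. Termwise integration of f needs
this. -/
instance : Countable ZeroIndex := by
  have h := (summable_exp_neg_alpha_sq_re one_pos).countable_support
  exact Set.countable_univ_iff.1 (h.mono fun i _ => (Real.exp_pos _).ne')

/-! ### The incomplete gamma function as a Laplace-type integral -/

theorem exists_rpow_le_mul_exp {δ ε : ℝ} (hδ : 0 < δ) (hε : 0 < ε) (p : ℝ) :
    ∃ C, 0 ≤ C ∧ ∀ x, δ ≤ x → x ^ p ≤ C * Real.exp (ε * x) := by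
  have h := ((isLittleO_rpow_exp_pos_mul_atTop p hε).bound one_pos)
  obtain ⟨x₀, hx₀⟩ := eventually_atTop.1 h
  have hc : ContinuousOn (fun x : ℝ => x ^ p) (Icc δ x₀) := fun x hx =>
    (Real.continuousAt_rpow_const _ _ (Or.inl (hδ.trans_le hx.1).ne')).continuousWithinAt
  obtain ⟨C, hC⟩ := isCompact_Icc.exists_bound_of_continuousOn hc
  refine ⟨max C 1, le_max_of_le_right zero_le_one, fun x hx => ?_⟩
  have he : 1 ≤ Real.exp (ε * x) := Real.one_le_exp (mul_nonneg hε.le (hδ.le.trans hx))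
  rcases le_total x x₀ with h1 | h1
  · have := (le_abs_self _).trans ((hC x ⟨hx, h1⟩).trans (le_max_left C 1))
    nlinarith [le_max_right C 1]
  · have h2 := hx₀ x h1
    rw [Real.norm_of_nonneg (Real.exp_nonneg _), one_mul] at h2
    have := (le_abs_self _).trans h2
    nlinarith [le_max_right C 1]

theorem norm_cpow_le_rpow_mul (z w : ℂ) : ‖z ^ w‖ ≤ ‖z‖ ^ w.re * Real.exp (Real.pi * |w.im|) := by
  refine (norm_cpow_le z w).trans ?_
  rw [div_eq_mul_inv, ← Real.exp_neg]
  gcongr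
  calc -(arg z * w.im) ≤ |arg z| * |w.im| := by
        rw [← abs_mul]
        exact neg_le_abs _
    _ ≤ _ := by
        gcongr
        exact abs_arg_le_pi z

/-- A majorant uniform in z, for differentiating under the integral sign: half of the decay of
exp(-u) absorbs the power. -/
theorem exists_norm_cpow_mul_exp_le {δ : ℝ} (hδ : 0 < δ) (R : ℝ) (w : ℂ) :
    ∃ C, 0 ≤ C ∧ ∀ z : ℂ, δ ≤ z.re → ‖z‖ ≤ R → ∀ u : ℝ, 0 ≤ u →
      ‖(z + u) ^ w * exp (-(z + u))‖ ≤ C * Real.exp (-(1 / 2) * u) := by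
  obtain ⟨C, hC0, hC⟩ := exists_rpow_le_mul_exp hδ one_half_pos w.re
  refine ⟨C * Real.exp (1 / 2 * R) * Real.exp (Real.pi * |w.im|), by positivity,
    fun z hz hR u hu => ?_⟩
  have h1 : δ ≤ ‖z + u‖ := by
    refine le_trans ?_ (re_le_norm _)
    simp
    linarith
  have h2 : ‖z + u‖ ≤ R + u := by
    refine (norm_add_le _ _).trans ?_
    rw [norm_real, Real.norm_of_nonneg hu]
    linarith
  have h3 : ‖exp (-(z + u))‖ ≤ Real.exp (-u) := by
    rw [norm_exp]
    apply Real.exp_le_exp.2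
    simp
    linarith
  rw [norm_mul]
  calc ‖(z + u) ^ w‖ * ‖exp (-(z + u))‖
      ≤ (C * Real.exp (1 / 2 * (R + u)) * Real.exp (Real.pi * |w.im|)) * Real.exp (-u) := by
        gcongr
        refine (norm_cpow_le_rpow_mul _ _).trans ?_
        gcongr
        refine (hC _ h1).trans ?_
        gcongr
    _ = C * Real.exp (1 / 2 * R) * Real.exp (Real.pi * |w.im|) * Real.exp (-(1 / 2) * u) := by
        rw [mul_add, Real.exp_add, show -(1 / 2) * u = 1 / 2 * u + -u by ring, Real.exp_add]
        ring

theorem mem_slitPlane_add {z : ℂ} (hz : 0 < z.re) {u : ℝ} (hu : 0 ≤ u) : z + u ∈ slitPlane := by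
  rw [mem_slitPlane_iff]
  left
  simp
  linarith

theorem aestronglyMeasurable_cpow_mul_exp {z : ℂ} (hz : 0 < z.re) (w : ℂ) :
    AEStronglyMeasurable (fun u : ℝ => (z + u) ^ w * exp (-(z + u)))
      (volume.restrict (Ioi 0)) := by
  refine ContinuousOn.aestronglyMeasurable (fun u (hu : 0 < u) => ?_) measurableSet_Ioi
  refine ContinuousAt.continuousWithinAt (ContinuousAt.mul ?_ (by fun_prop))
  exact ContinuousAt.cpow (by fun_prop) continuousAt_const (mem_slitPlane_add hz hu.le)

theorem integrableOn_exp_neg_mul {c : ℝ} (hc : 0 < c) (a : ℝ) :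
    IntegrableOn (fun x => Real.exp (-c * x)) (Ioi a) :=
  exp_neg_integrableOn_Ioi a hc

theorem integrableOn_cpow_mul_exp {z : ℂ} (hz : 0 < z.re) (w : ℂ) :
    IntegrableOn (fun u : ℝ => (z + u) ^ w * exp (-(z + u))) (Ioi 0) := by
  obtain ⟨C, -, hC⟩ := exists_norm_cpow_mul_exp_le hz ‖z‖ w
  refine Integrable.mono' ((integrableOn_exp_neg_mul one_half_pos 0).const_mul C)
    (aestronglyMeasurable_cpow_mul_exp hz w) ?_
  exact (ae_restrict_iff' measurableSet_Ioi).2 (ae_of_all _ fun u (hu : 0 < u) =>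
    hC z le_rfl le_rfl u hu.le)

theorem half_re_le_of_mem_ball {z₀ z : ℂ} (hz : z ∈ Metric.ball z₀ (z₀.re / 2)) :
    z₀.re / 2 ≤ z.re ∧ ‖z‖ ≤ ‖z₀‖ + z₀.re / 2 := by
  rw [mem_ball_iff_norm] at hz
  have h1 := (abs_re_le_norm (z - z₀)).trans hz.le
  rw [sub_re, abs_le] at h1
  have h2 := norm_add_le z₀ (z - z₀)
  rw [add_sub_cancel] at h2
  exact ⟨by linarith, by linarith⟩

theorem differentiableOn_incompleteGamma (w : ℂ) :
    DifferentiableOn ℂ (incompleteGamma w) {z | 0 < z.re} := by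
  intro z₀ (hz₀ : 0 < z₀.re)
  obtain ⟨C₁, -, hC₁⟩ := exists_norm_cpow_mul_exp_le (half_pos hz₀) (‖z₀‖ + z₀.re / 2) (w - 1)
  obtain ⟨C₂, -, hC₂⟩ := exists_norm_cpow_mul_exp_le (half_pos hz₀) (‖z₀‖ + z₀.re / 2) (w - 1 - 1)
  have h := hasDerivAt_integral_of_dominated_loc_of_deriv_le (μ := volume.restrict (Ioi (0 : ℝ)))
    (F := fun (z : ℂ) (u : ℝ) => (z + u) ^ (w - 1) * exp (-(z + u)))
    (F' := fun (z : ℂ) (u : ℝ) => (w - 1) * ((z + u) ^ (w - 1 - 1) * exp (-(z + u))) -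
      (z + u) ^ (w - 1) * exp (-(z + u)))
    (bound := fun u => ‖w - 1‖ * (C₂ * Real.exp (-(1 / 2) * u)) + C₁ * Real.exp (-(1 / 2) * u))
    (Metric.ball_mem_nhds z₀ (half_pos hz₀)) ?_ (integrableOn_cpow_mul_exp hz₀ _) ?_ ?_ ?_ ?_
  · exact h.2.differentiableAt.differentiableWithinAt
  · filter_upwards [Metric.ball_mem_nhds z₀ (half_pos hz₀)] with z hz
    exact aestronglyMeasurable_cpow_mul_exp
      ((half_pos hz₀).trans_le (half_re_le_of_mem_ball hz).1) _
  · exact ((aestronglyMeasurable_cpow_mul_exp hz₀ _).const_mul _).sub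
      (aestronglyMeasurable_cpow_mul_exp hz₀ _)
  · refine (ae_restrict_iff' measurableSet_Ioi).2 (ae_of_all _ fun u (hu : 0 < u) z hz => ?_)
    obtain ⟨h1, h2⟩ := half_re_le_of_mem_ball hz
    refine (norm_sub_le _ _).trans (add_le_add ?_ (hC₁ z h1 h2 u hu.le))
    rw [norm_mul]
    gcongr
    exact hC₂ z h1 h2 u hu.le
  · exact (((integrableOn_exp_neg_mul one_half_pos 0).const_mul _).const_mul _).add
      ((integrableOn_exp_neg_mul one_half_pos 0).const_mul _)
  · refine (ae_restrict_iff' measurableSet_Ioi).2 (ae_of_all _ fun u (hu : 0 < u) z hz => ?_)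
    have hz' : 0 < z.re := (half_pos hz₀).trans_le (half_re_le_of_mem_ball hz).1
    have h1 : HasDerivAt (fun z : ℂ => z + u) 1 z := (hasDerivAt_id z).add_const _
    have h2 : HasDerivAt (fun z : ℂ => -(z + u)) (-1) z := h1.neg
    refine ((h1.cpow_const (c := w - 1) (mem_slitPlane_add hz' hu.le)).mul
      h2.cexp).congr_deriv ?_
    ring

theorem exists_norm_exp_mul_cpow_le {a δ : ℝ} (ha : 0 < a) (hδ : 0 < δ) (w : ℂ) :
    ∃ C, 0 ≤ C ∧ ∀ z : ℂ, δ ≤ z.re → ∀ x : ℝ, a < x →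
      ‖exp (-z * x) * (x : ℂ) ^ w‖ ≤ C * Real.exp (-(δ / 2) * x) := by
  obtain ⟨C, hC0, hC⟩ := exists_rpow_le_mul_exp ha (half_pos hδ) w.re
  refine ⟨C, hC0, fun z hz x hx => ?_⟩
  rw [norm_mul, norm_cpow_eq_rpow_re_of_pos (ha.trans hx), norm_exp]
  calc Real.exp (-z * x).re * x ^ w.re
      ≤ Real.exp (-δ * x) * (C * Real.exp (δ / 2 * x)) := by
        refine mul_le_mul (Real.exp_le_exp.2 ?_) (hC x hx.le)
          (Real.rpow_nonneg (ha.trans hx).le _) (Real.exp_nonneg _)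
        simp
        nlinarith
    _ = _ := by
        rw [show -(δ / 2) * x = -δ * x + δ / 2 * x by ring, Real.exp_add]
        ring

theorem aestronglyMeasurable_exp_mul_cpow {a : ℝ} (ha : 0 < a) (z w : ℂ) :
    AEStronglyMeasurable (fun x : ℝ => exp (-z * x) * (x : ℂ) ^ w) (volume.restrict (Ioi a)) := by
  refine ContinuousOn.aestronglyMeasurable (fun x (hx : a < x) => ?_) measurableSet_Ioi
  refine ContinuousAt.continuousWithinAt (ContinuousAt.mul (by fun_prop) ?_)
  exact ContinuousAt.cpow (by fun_prop) continuousAt_const (ofReal_mem_slitPlane.2 (ha.trans hx))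

theorem integrableOn_exp_mul_cpow {a : ℝ} (ha : 0 < a) {z : ℂ} (hz : 0 < z.re) (w : ℂ) :
    IntegrableOn (fun x : ℝ => exp (-z * x) * (x : ℂ) ^ w) (Ioi a) := by
  obtain ⟨C, -, hC⟩ := exists_norm_exp_mul_cpow_le ha hz w
  refine Integrable.mono' ((integrableOn_exp_neg_mul (half_pos hz) a).const_mul C)
    (aestronglyMeasurable_exp_mul_cpow ha z w) ?_
  exact (ae_restrict_iff' measurableSet_Ioi).2 (ae_of_all _ fun x hx => hC z le_rfl x hx)

theorem differentiableOn_integral_exp_mul_cpow {a : ℝ} (ha : 0 < a) (w : ℂ) :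
    DifferentiableOn ℂ (fun z => ∫ x : ℝ in Ioi a, exp (-z * x) * (x : ℂ) ^ w) {z | 0 < z.re} := by
  intro z₀ (hz₀ : 0 < z₀.re)
  obtain ⟨C, -, hC⟩ := exists_norm_exp_mul_cpow_le ha (half_pos hz₀) (w + 1)
  have h := hasDerivAt_integral_of_dominated_loc_of_deriv_le (μ := volume.restrict (Ioi a))
    (F := fun (z : ℂ) (x : ℝ) => exp (-z * x) * (x : ℂ) ^ w)
    (F' := fun (z : ℂ) (x : ℝ) => -(exp (-z * x) * (x : ℂ) ^ (w + 1)))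
    (bound := fun x => C * Real.exp (-(z₀.re / 2 / 2) * x))
    (Metric.ball_mem_nhds z₀ (half_pos hz₀))
    (Eventually.of_forall fun z => aestronglyMeasurable_exp_mul_cpow ha z w)
    (integrableOn_exp_mul_cpow ha hz₀ w) (aestronglyMeasurable_exp_mul_cpow ha z₀ (w + 1)).neg
    ?_ ((integrableOn_exp_neg_mul (half_pos (half_pos hz₀)) a).const_mul C) ?_
  · exact h.2.differentiableAt.differentiableWithinAt
  · refine (ae_restrict_iff' measurableSet_Ioi).2 (ae_of_all _ fun x hx z hz => ?_)
    rw [norm_neg]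
    exact hC z (half_re_le_of_mem_ball hz).1 x hx
  · refine (ae_restrict_iff' measurableSet_Ioi).2 (ae_of_all _ fun x (hx : a < x) z hz => ?_)
    have h1 : HasDerivAt (fun z : ℂ => -z * x) (-1 * x) z := (hasDerivAt_id z).neg.mul_const _
    refine (h1.cexp.mul_const ((x : ℂ) ^ w)).congr_deriv ?_
    rw [cpow_add _ _ (ofReal_ne_zero.2 (ha.trans hx).ne'), cpow_one]
    ring

theorem incompleteGamma_ofReal (w : ℂ) (c : ℝ) :
    incompleteGamma w c = ∫ t : ℝ in Ioi c, (t : ℂ) ^ (w - 1) * exp (-t) := by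
  have h := (measurePreserving_add_left volume c).setIntegral_preimage_emb
    (measurableEmbedding_addLeft c) (fun t : ℝ => (t : ℂ) ^ (w - 1) * exp (-t)) (Ioi c)
  rw [← h, incompleteGamma]
  simp

theorem integral_exp_mul_cpow_of_pos {a : ℝ} (ha : 0 < a) (w : ℂ) {z : ℝ} (hz : 0 < z) :
    (z : ℂ) ^ w * ∫ x : ℝ in Ioi a, exp (-z * x) * (x : ℂ) ^ (w - 1) =
      incompleteGamma w (a * z) := by
  have h0 : (z : ℂ) ≠ 0 := ofReal_ne_zero.2 hz.ne'
  rw [← ofReal_mul, mul_comm a z, incompleteGamma_ofReal,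
    ← integral_comp_mul_left_Ioi' (fun t : ℝ => (t : ℂ) ^ (w - 1) * exp (-t)) a hz,
    real_smul, ← integral_const_mul, ← integral_const_mul]
  refine setIntegral_congr_fun measurableSet_Ioi fun x hx => ?_
  have hx0 : 0 < x := ha.trans hx
  rw [ofReal_mul, mul_cpow_ofReal_nonneg hz.le hx0.le, cpow_sub _ _ h0, cpow_one, neg_mul]
  field_simp

/-- Both sides are holomorphic on Re z > 0 and agree on the positive reals, hence at the points 1 +
1/(n+1), which accumulate at 1. -/
theorem integral_exp_mul_cpow {a : ℝ} (ha : 0 < a) (w : ℂ) {z : ℂ} (hz : 0 < z.re) :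
    z ^ w * ∫ x : ℝ in Ioi a, exp (-z * x) * (x : ℂ) ^ (w - 1) = incompleteGamma w (a * z) := by
  have hU : IsOpen {z : ℂ | 0 < z.re} := isOpen_lt continuous_const continuous_re
  have hL : DifferentiableOn ℂ
      (fun z : ℂ => z ^ w * ∫ x : ℝ in Ioi a, exp (-z * x) * (x : ℂ) ^ (w - 1)) {z | 0 < z.re} :=
    DifferentiableOn.mul (fun z (hz : 0 < z.re) => ((hasDerivAt_id z).cpow_const
      (Or.inl hz)).differentiableAt.differentiableWithinAt)
      (differentiableOn_integral_exp_mul_cpow ha (w - 1))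
  have hR : DifferentiableOn ℂ (fun z : ℂ => incompleteGamma w (a * z)) {z | 0 < z.re} :=
    (differentiableOn_incompleteGamma w).comp (by fun_prop) fun z (hz : 0 < z.re) => by
      simpa using mul_pos ha hz
  refine AnalyticOnNhd.eqOn_of_preconnected_of_frequently_eq (hL.analyticOnNhd hU)
    (hR.analyticOnNhd hU) (convex_halfSpace_re_gt 0).isPreconnected (z₀ := 1) (by simp) ?_ hz
  have ht : Tendsto (fun n : ℕ => ((1 + 1 / ((n : ℝ) + 1) : ℝ) : ℂ)) atTop (𝓝[≠] 1) := by
    refine tendsto_nhdsWithin_iff.2 ⟨?_, Eventually.of_forall fun n => ?_⟩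
    · have := (tendsto_one_div_add_atTop_nhds_zero_nat (𝕜 := ℝ)).const_add 1
      rw [add_zero] at this
      exact (continuous_ofReal.tendsto 1).comp this
    · have : (0 : ℝ) < 1 / ((n : ℝ) + 1) := by positivity
      intro h
      have h' : (1 + 1 / ((n : ℝ) + 1) : ℝ) = 1 := ofReal_injective (h.trans ofReal_one.symm)
      linarith
  exact ht.frequently (Eventually.frequently (Eventually.of_forall fun n =>
    integral_exp_mul_cpow_of_pos ha w (by positivity)))

/-! ### Termwise integration and locally uniform convergence -/

theorem ZeroIndex.alpha_sq_re_pos (i : ZeroIndex) : 0 < (i.alpha ^ 2).re :=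
  one_half_pos.trans_le i.half_le_alpha_sq_re

theorem ZeroIndex.alpha_ne_zero (i : ZeroIndex) : i.alpha ≠ 0 := fun h => by
  simpa [h] using i.alpha_re_pos

/-- Since Re α > 0, |arg α| < π/2, so doubling the argument does not leave the principal branch. -/
theorem ZeroIndex.alpha_sq_cpow (i : ZeroIndex) (s : ℂ) :
    (i.alpha ^ 2) ^ (s / 2) = i.alpha ^ s := by
  have h := abs_lt.1 (abs_arg_lt_pi_div_two_iff.2 (Or.inl i.alpha_re_pos))
  have := cpow_nat_mul' (x := i.alpha) (n := 2) (by push_cast; linarith) (by push_cast; linarith)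
    (s / 2)
  rw [← this]
  congr 1
  push_cast
  ring

theorem seriesTerm_eq {a : ℝ} (ha : 0 < a) (i : ZeroIndex) (s : ℂ) :
    seriesTerm a i s = (Gamma (s / 2))⁻¹ *
      ∫ x : ℝ in Ioi a, exp (-i.alpha ^ 2 * x) * (x : ℂ) ^ (s / 2 - 1) := by
  have h : i.alpha ^ s ≠ 0 := by simp [cpow_eq_zero_iff, i.alpha_ne_zero]
  rw [seriesTerm, ← integral_exp_mul_cpow ha _ i.alpha_sq_re_pos, i.alpha_sq_cpow]
  field_simp

/-- Split x into two halves: one is at least a/2 and keeps the dependence on the zero, the other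
meets Re α² ≥ 1/2 and gives decay in x. -/
theorem exp_neg_alpha_sq_re_mul_le (i : ZeroIndex) {a x : ℝ} (hx : a < x) (ha : 0 < a) :
    Real.exp (-(i.alpha ^ 2).re * x) ≤
      Real.exp (-(i.alpha ^ 2).re * (a / 2)) * Real.exp (-(1 / 4) * x) := by
  rw [← Real.exp_add]
  apply Real.exp_le_exp.2
  nlinarith [i.half_le_alpha_sq_re]

theorem exists_norm_exp_alpha_mul_cpow_le {a : ℝ} (ha : 0 < a) (M : ℝ) :
    ∃ C, 0 ≤ C ∧ ∀ (i : ZeroIndex) (w : ℂ), |w.re| ≤ M → ∀ x : ℝ, a < x →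
      ‖exp (-i.alpha ^ 2 * x) * (x : ℂ) ^ w‖ ≤
        C * Real.exp (-(i.alpha ^ 2).re * (a / 2)) * Real.exp (-(1 / 8) * x) := by
  obtain ⟨C₁, h10, h1⟩ := exists_rpow_le_mul_exp ha (by norm_num : (0 : ℝ) < 1 / 8) M
  obtain ⟨C₂, h20, h2⟩ := exists_rpow_le_mul_exp ha (by norm_num : (0 : ℝ) < 1 / 8) (-M)
  refine ⟨C₁ + C₂, by positivity, fun i w hw x hx => ?_⟩
  have hx0 : 0 < x := ha.trans hx
  obtain ⟨hw1, hw2⟩ := abs_le.1 hw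
  -- The exponent M controls x ≥ 1 and -M controls x ≤ 1. The rate 1/8 is half of the available
  -- decay 1/4.
  have hp : x ^ w.re ≤ (C₁ + C₂) * Real.exp (1 / 8 * x) := by
    rw [add_mul]
    rcases le_total 1 x with h | h
    · have := (Real.rpow_le_rpow_of_exponent_le h hw2).trans (h1 x hx.le)
      have : 0 ≤ C₂ * Real.exp (1 / 8 * x) := by positivity
      linarith
    · have := (Real.rpow_le_rpow_of_exponent_ge hx0 h hw1).trans (h2 x hx.le)
      have : 0 ≤ C₁ * Real.exp (1 / 8 * x) := by positivity
      linarith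
  rw [norm_mul, norm_exp_neg_alpha_sq_mul, norm_cpow_eq_rpow_re_of_pos hx0]
  calc Real.exp (-(i.alpha ^ 2).re * x) * x ^ w.re
      ≤ (Real.exp (-(i.alpha ^ 2).re * (a / 2)) * Real.exp (-(1 / 4) * x)) *
          ((C₁ + C₂) * Real.exp (1 / 8 * x)) := by
        gcongr
        exact exp_neg_alpha_sq_re_mul_le i hx ha
    _ = _ := by
        rw [show -(1 / 8) * x = -(1 / 4) * x + 1 / 8 * x by ring, Real.exp_add]
        ring

theorem exists_integral_norm_exp_alpha_mul_cpow_le {a : ℝ} (ha : 0 < a) (M : ℝ) :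
    ∃ C, 0 ≤ C ∧ ∀ (i : ZeroIndex) (w : ℂ), |w.re| ≤ M →
      ∫ x : ℝ in Ioi a, ‖exp (-i.alpha ^ 2 * x) * (x : ℂ) ^ w‖ ≤
        C * Real.exp (-(i.alpha ^ 2).re * (a / 2)) := by
  obtain ⟨C, hC0, hC⟩ := exists_norm_exp_alpha_mul_cpow_le ha M
  refine ⟨C * ∫ x : ℝ in Ioi a, Real.exp (-(1 / 8) * x),
    mul_nonneg hC0 (integral_nonneg fun _ => Real.exp_nonneg _), fun i w hw => ?_⟩
  refine (setIntegral_mono_on (integrableOn_exp_mul_cpow ha i.alpha_sq_re_pos w).norm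
    ((integrableOn_exp_neg_mul (by norm_num) a).const_mul _) measurableSet_Ioi
    (hC i w hw)).trans_eq ?_
  rw [integral_const_mul]
  ring

theorem hasSum_integral_f_mul_cpow {a : ℝ} (ha : 0 < a) (w : ℂ) :
    HasSum (fun i : ZeroIndex => ∫ x : ℝ in Ioi a, exp (-i.alpha ^ 2 * x) * (x : ℂ) ^ w)
      (∫ x : ℝ in Ioi a, f x * (x : ℂ) ^ w) := by
  obtain ⟨C, -, hC⟩ := exists_integral_norm_exp_alpha_mul_cpow_le ha |w.re|
  have h := hasSum_integral_of_summable_integral_norm (μ := volume.restrict (Ioi a))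
    (F := fun (i : ZeroIndex) (x : ℝ) => exp (-i.alpha ^ 2 * x) * (x : ℂ) ^ w)
    (fun i => integrableOn_exp_mul_cpow ha i.alpha_sq_re_pos w)
    (Summable.of_nonneg_of_le (fun i => integral_nonneg fun _ => norm_nonneg _)
      (fun i => hC i w le_rfl) ((summable_exp_neg_alpha_sq_re (half_pos ha)).mul_left C))
  simpa only [f, tsum_mul_right] using h

theorem A_eq_tsum {a : ℝ} (ha : 0 < a) (s : ℂ) :
    A a s = ∑' i : ZeroIndex, seriesTerm a i s := by
  simp_rw [seriesTerm_eq ha, tsum_mul_left]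
  rw [A, (hasSum_integral_f_mul_cpow ha _).tsum_eq]

/-- Weierstrass M-test on a compact set, where both 1/Γ(s/2) and Re(s/2 - 1) are bounded. -/
theorem hasSumLocallyUniformly_seriesTerm {a : ℝ} (ha : 0 < a) :
    HasSumLocallyUniformly (seriesTerm a) (A a) := by
  refine hasSumLocallyUniformly_of_forall_compact fun K hK => ?_
  obtain ⟨M, hM⟩ := hK.exists_bound_of_continuousOn
    (f := fun s : ℂ => (s / 2 - 1).re) (by fun_prop)
  have hΓ : Differentiable ℂ fun s : ℂ => (Gamma (s / 2))⁻¹ :=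
    differentiable_one_div_Gamma.comp (by fun_prop)
  obtain ⟨B, hB⟩ := hK.exists_bound_of_continuousOn hΓ.continuous.continuousOn
  obtain ⟨C, hC0, hC⟩ := exists_integral_norm_exp_alpha_mul_cpow_le ha M
  rw [funext (A_eq_tsum ha)]
  refine HasSumUniformlyOn.of_norm_le_summable
    (((summable_exp_neg_alpha_sq_re (half_pos ha)).mul_left C).mul_left B) fun i s hs => ?_
  rw [seriesTerm_eq ha, norm_mul]
  exact mul_le_mul (hB s hs) ((norm_integral_le_integral_norm _).trans (hC i _ (hM s hs)))
    (norm_nonneg _) ((norm_nonneg _).trans (hB s hs))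

/-! ### A is entire -/

theorem norm_f_le {a x : ℝ} (ha : 0 < a) (hx : a < x) :
    ‖f x‖ ≤ (∑' i : ZeroIndex, Real.exp (-(i.alpha ^ 2).re * (a / 2))) *
      Real.exp (-(1 / 4) * x) := by
  rw [← tsum_mul_right]
  refine tsum_of_norm_bounded
    ((summable_exp_neg_alpha_sq_re (half_pos ha)).mul_right _).hasSum fun i => ?_
  rw [norm_exp_neg_alpha_sq_mul]
  exact exp_neg_alpha_sq_re_mul_le i hx ha

theorem continuousOn_f {a : ℝ} (ha : 0 < a) : ContinuousOn (fun x : ℝ => f x) (Ioi a) := by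
  refine continuousOn_tsum (u := fun i : ZeroIndex => Real.exp (-(i.alpha ^ 2).re * a))
    (fun i => by fun_prop) (summable_exp_neg_alpha_sq_re ha) fun i x (hx : a < x) => ?_
  rw [norm_exp_neg_alpha_sq_mul]
  apply Real.exp_le_exp.2
  nlinarith [i.alpha_sq_re_pos]

theorem integrableOn_f {a : ℝ} (ha : 0 < a) : IntegrableOn (fun x : ℝ => f x) (Ioi a) :=
  Integrable.mono' ((integrableOn_exp_neg_mul (by norm_num : (0 : ℝ) < 1 / 4) a).const_mul _)
    ((continuousOn_f ha).aestronglyMeasurable measurableSet_Ioi)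
    ((ae_restrict_iff' measurableSet_Ioi).2 (ae_of_all _ fun _ hx => norm_f_le ha hx))

/-- The restriction of `f` to `(a, ∞)`, extended by zero. -/
noncomputable def truncF (a : ℝ) : ℝ → ℂ := (Ioi a).indicator fun x : ℝ => f x

theorem locallyIntegrableOn_truncF {a : ℝ} (ha : 0 < a) :
    LocallyIntegrableOn (truncF a) (Ioi 0) :=
  ((integrable_indicator_iff measurableSet_Ioi).2
    (integrableOn_f ha)).locallyIntegrable.locallyIntegrableOn _

theorem truncF_isBigO_atTop {a : ℝ} (ha : 0 < a) :
    truncF a =O[atTop] fun t => Real.exp (-(1 / 4) * t) := by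
  refine Asymptotics.IsBigO.of_bound
    (∑' i : ZeroIndex, Real.exp (-(i.alpha ^ 2).re * (a / 2))) ?_
  filter_upwards [eventually_gt_atTop a] with x hx
  rw [truncF, indicator_of_mem (mem_Ioi.2 hx), Real.norm_of_nonneg (Real.exp_nonneg _)]
  exact norm_f_le ha hx

/-- The truncation vanishes near 0, so every b is allowed and the Mellin transform has no left
boundary of convergence. -/
theorem truncF_isBigO_zero {a : ℝ} (ha : 0 < a) (b : ℝ) :
    truncF a =O[𝓝[>] 0] fun t : ℝ => t ^ (-b) := by
  refine Asymptotics.IsBigO.of_bound 0 ?_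
  filter_upwards [nhdsWithin_le_nhds (Iio_mem_nhds ha)] with x (hx : x < a)
  simp [truncF, hx.le]

theorem mellin_integrand_truncF {a : ℝ} (ha : 0 < a) (s : ℂ) :
    (Ioi 0).indicator (fun t : ℝ => (t : ℂ) ^ (s - 1) • truncF a t) =
      (Ioi a).indicator fun x : ℝ => f x * (x : ℂ) ^ (s - 1) := by
  ext x
  by_cases hx : a < x
  · simp [truncF, hx, ha.trans hx, mul_comm]
  · simp [truncF, hx]

theorem integrableOn_f_mul_cpow {a : ℝ} (ha : 0 < a) (s : ℂ) :
    IntegrableOn (fun x : ℝ => f x * (x : ℂ) ^ (s - 1)) (Ioi a) := by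
  rw [← integrable_indicator_iff measurableSet_Ioi, ← mellin_integrand_truncF ha,
    integrable_indicator_iff measurableSet_Ioi]
  exact mellinConvergent_of_isBigO_rpow_exp (by norm_num : (0 : ℝ) < 1 / 4)
    (locallyIntegrableOn_truncF ha) (truncF_isBigO_atTop ha)
    (truncF_isBigO_zero ha (s.re - 1)) (by linarith)

theorem mellin_truncF {a : ℝ} (ha : 0 < a) (s : ℂ) :
    mellin (truncF a) s = ∫ x : ℝ in Ioi a, f x * (x : ℂ) ^ (s - 1) := by
  rw [mellin, ← integral_indicator measurableSet_Ioi, mellin_integrand_truncF ha,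
    integral_indicator measurableSet_Ioi]

theorem differentiable_A {a : ℝ} (ha : 0 < a) : Differentiable ℂ (A a) := by
  have hm : Differentiable ℂ (mellin (truncF a)) := fun s =>
    mellin_differentiableAt_of_isBigO_rpow_exp (by norm_num : (0 : ℝ) < 1 / 4)
      (locallyIntegrableOn_truncF ha) (truncF_isBigO_atTop ha)
      (truncF_isBigO_zero ha (s.re - 1)) (by linarith)
  have hA : A a = fun s => (Gamma (s / 2))⁻¹ * mellin (truncF a) (s / 2) := by
    ext s
    rw [A, mellin_truncF ha]
  rw [hA]
  have h2 : Differentiable ℂ fun s : ℂ => s / 2 := by fun_prop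
  exact (differentiable_one_div_Gamma.comp h2).mul (hm.comp h2)

/-! ### Sequential arrangements and the theorem -/

theorem _root_.HasSumLocallyUniformly.tendstoLocallyUniformly_range {ι α β : Type*}
    [AddCommMonoid α] [UniformSpace α] [TopologicalSpace β] {g : ι → β → α} {G : β → α}
    (h : HasSumLocallyUniformly g G) (e : ℕ ≃ ι) :
    TendstoLocallyUniformly (fun (N : ℕ) (s : β) => ∑ n ∈ Finset.range N, g (e n) s) G atTop := by
  -- The images of the initial segments under the enumeration are cofinal among the finite index
  -- sets.
  have ht : Tendsto (fun N => (Finset.range N).map e.toEmbedding) atTop atTop := by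
    refine tendsto_atTop_finset_of_monotone
      (fun m n hmn => Finset.map_subset_map.2 (Finset.range_mono hmn)) fun i => ?_
    exact ⟨e.symm i + 1, Finset.mem_map.2 ⟨e.symm i, by simp, by simp⟩⟩
  intro u hu x
  obtain ⟨t, htx, hev⟩ := h u hu x
  refine ⟨t, htx, (ht.eventually hev).mono fun N hN y hy => ?_⟩
  simpa using hN y hy

end SecondaryZeta

theorem mainTheorem3 (a : ℝ) (ha : 0 < a) :
    -- the series for `f` and the integrals that define `A` converge
    (∀ x : ℝ, 0 < x →
      Summable fun i : SecondaryZeta.ZeroIndex => Complex.exp (-i.alpha ^ 2 * (x : ℂ))) ∧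
    (∀ s : ℂ, MeasureTheory.IntegrableOn
      (fun x : ℝ => SecondaryZeta.f x * (x : ℂ) ^ (s / 2 - 1)) (Set.Ioi a)) ∧
    (∀ (s : ℂ) (i : SecondaryZeta.ZeroIndex), MeasureTheory.IntegrableOn
      (fun u : ℝ => (a * i.alpha ^ 2 + u) ^ (s / 2 - 1) * Complex.exp (-(a * i.alpha ^ 2 + u)))
      (Set.Ioi 0)) ∧
    (∀ i : SecondaryZeta.ZeroIndex, a * i.alpha ^ 2 ∈ Complex.slitPlane) ∧
    -- `A` is entire
    Differentiable ℂ (SecondaryZeta.A a) ∧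
    -- the series converges to `A`, unconditionally and locally uniformly on the whole plane
    HasSumLocallyUniformly (SecondaryZeta.seriesTerm a) (SecondaryZeta.A a) ∧
    -- in particular along every arrangement of the zeros in a sequence
    ∀ ρ : ℕ ≃ SecondaryZeta.ZeroIndex,
      TendstoLocallyUniformly
        (fun (N : ℕ) (s : ℂ) => ∑ n ∈ Finset.range N, SecondaryZeta.seriesTerm a (ρ n) s)
        (SecondaryZeta.A a) Filter.atTop := by
  have hre : ∀ i : SecondaryZeta.ZeroIndex, 0 < (a * i.alpha ^ 2 : ℂ).re := fun i => by
    rw [Complex.re_ofReal_mul]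
    exact mul_pos ha i.alpha_sq_re_pos
  refine ⟨fun x hx => ?_, fun s => SecondaryZeta.integrableOn_f_mul_cpow ha (s / 2), fun s i =>
    SecondaryZeta.integrableOn_cpow_mul_exp (hre i) (s / 2 - 1), fun i => Or.inl (hre i),
    SecondaryZeta.differentiable_A ha, SecondaryZeta.hasSumLocallyUniformly_seriesTerm ha,
    (SecondaryZeta.hasSumLocallyUniformly_seriesTerm ha).tendstoLocallyUniformly_range⟩
  exact Summable.of_norm_bounded (SecondaryZeta.summable_exp_neg_alpha_sq_re hx)
    fun i => (SecondaryZeta.norm_exp_neg_alpha_sq_mul i x).le
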